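/- Let $n\ge 1$, $t>0$ and $x_0=(x_{10},\dots,x_{n0})\in\mathbb{R}^n$. Consider the $n$-th order integrator $$\dot x_k=x_{k+1}\ (1\le k\le n-1),\qquad \dot x_n=u,\qquad x(0)=x_0,$$ and let $u_{\min},u_{\max}:[0,t]\to\mathbb{R}$ be continuous with $u_{\min}\le u_{\max}$. The reach set $\mathcal{X}_t(\{x_0\})\subset\mathbb{R}^n$ is the set of all states $x(t)$ of solutions with a continuous input $u:[0,t]\to\mathbb{R}$ satisfying $u_{\min}(s)\le u(s)\le u_{\max}(s)$ for all $s\in[0,t]$. Put $$\chi_k(t,x_0)=\sum_{\ell=k}^{n}\frac{t^{\ell-k}}{(\ell-k)!}\,x_{\ell 0}\ (1\le k\le n),\qquad \xi(s)=\Big(\tfrac{s^{n-1}}{(n-1)!},\tfrac{s^{n-2}}{(n-2)!},\dots,s,1\Big)^{\top},$$ $$\mu(s)=\tfrac12\big(u_{\max}(s)-u_{\min}(s)\big),\qquad \nu(s)=\tfrac12\big(u_{\max}(s)+u_{\min}(s)\big),$$ and let $\mathcal{W}_t=\{\sigma\in\mathbb{R}^{n-1}: 0\le\sigma_1\le\dots\le\sigma_{n-1}\le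 t\}$. With $\sigma_0:=0$ and $\sigma_n:=t$, define for $\sigma\in\mathcal{W}_t$ $$x^{\pm}(\sigma)=\chi(t,x_0)+\int_0^t\nu(s)\,\xi(t-s)\,ds\;\pm\;\sum_{k=0}^{n-1}(-1)^{k}\int_{\sigma_{k}}^{\sigma_{k+1}}\mu(s)\,\xi(t-s)\,ds .$$ Then the topological boundary of the reach set is $$\partial\mathcal{X}_t(\{x_0\})=\{x^{+}(\sigma):\sigma\in\mathcal{W}_t\}\cup\{x^{-}(\sigma):\sigma\in\mathcal{W}_t\}.$$ In particular, this holds for the input range induced by a controllable system $\dot z=Az+bv$, $z(0)=z_0$, with $A\in\mathbb{R}^{n\times n}$, $b\in\mathbb{R}^n$ and constant input bounds $v_{\min}\le v_{\max}$, as follows. Let $q^{\top}$ be the last row of the inverse of the controllability matrix $(b,Ab,\dots,A^{n-1}b)$, let $M$ be the matrix with rows $q^{\top},q^{\top}A,\dots,q^{\top}A^{n-1}$, let $c=(c_0,\dots,c_{n-1})^{\top}$ where $\lambda^n+c_{n-1}\lambda^{n-1}+\dots+c_0$ is the characteristic polynomial of $A$, let $A_{\rm con}$ be the companion matrix with ones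 on the superdiagonal, last row $-c^{\top}$ and zeros elsewhere, and let $b_{\rm con}=(0,\dots,0,1)^{\top}$. Take $x_0=Mz_0$ and, for $s\in[0,t]$, with $f_s(\tau)=\langle c,e^{(s-\tau)A_{\rm con}}b_{\rm con}\rangle$, $$u_{\min}(s)=-\langle c,e^{sA_{\rm con}}Mz_0\rangle+v_{\min}-v_{\min}\int_{\{\tau\in[0,s]:f_s(\tau)\le 0\}}f_s(\tau)\,d\tau-v_{\max}\int_{\{\tau\in[0,s]:f_s(\tau)>0\}}f_s(\tau)\,d\tau,$$ $$u_{\max}(s)=-\langle c,e^{sA_{\rm con}}Mz_0\rangle+v_{\max}-v_{\max}\int_{\{\tau\in[0,s]:f_s(\tau)\le 0\}}f_s(\tau)\,d\tau-v_{\min}\int_{\{\tau\in[0,s]:f_s(\tau)>0\}}f_s(\tau)\,d\tau.$$ -/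

import Mathlib

open Set MeasureTheory
open scoped Matrix Nat

/-! The state dimension is `n = m + 1 ≥ 1`.  States are vectors `Fin (m + 1) → ℝ`, whose topology is
the usual one of `ℝⁿ`.  The coordinate with (one-based) number `k` is the index `k - 1`. -/

namespace LTIReach

noncomputable section

/-- The state matrix of the `n`-th order integrator: ones on the superdiagonal, zeros elsewhere. -/
def aInt (m : ℕ) : Matrix (Fin (m + 1)) (Fin (m + 1)) ℝ :=
  Matrix.of fun i j => if (j : ℕ) = (i : ℕ) + 1 then 1 else 0

/-- The input vector `(0, …, 0, 1)ᵀ`. -/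
def bCon (m : ℕ) : Fin (m + 1) → ℝ :=
  Pi.single (Fin.last m) 1

/-- The integrator reach set at time `t` from the initial state `x₀`: the endpoints `x t` of the
solutions of `ẋ = aInt x + bCon u`, `x 0 = x₀`, over all continuous inputs `u` on `[0, t]` with
`uMin s ≤ u s ≤ uMax s` for all `s ∈ [0, t]`. -/
def integratorReachSet {m : ℕ} (t : ℝ) (x₀ : Fin (m + 1) → ℝ) (uMin uMax : ℝ → ℝ) :
    Set (Fin (m + 1) → ℝ) :=
  {p | ∃ (u : ℝ → ℝ) (x : ℝ → Fin (m + 1) → ℝ),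
    ContinuousOn u (Icc 0 t) ∧
    (∀ s ∈ Icc 0 t, u s ∈ Icc (uMin s) (uMax s)) ∧
    x 0 = x₀ ∧
    (∀ s ∈ Icc 0 t,
      HasDerivWithinAt x (aInt m *ᵥ x s + u s • bCon m) (Icc 0 t) s) ∧
    x t = p}

/-- `χ_k(t, x₀) = ∑_ℓ 1_{k ≤ ℓ} t^(ℓ-k) / (ℓ-k)! x_{ℓ0}`. -/
def chi {m : ℕ} (t : ℝ) (x₀ : Fin (m + 1) → ℝ) : Fin (m + 1) → ℝ :=
  fun k => ∑ l : Fin (m + 1),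
    if k ≤ l then t ^ ((l : ℕ) - (k : ℕ)) / (((l : ℕ) - (k : ℕ))! : ℝ) * x₀ l else 0

/-- `ξ(s) = (s^(n-1)/(n-1)!, s^(n-2)/(n-2)!, …, s, 1)ᵀ`. -/
def xi (m : ℕ) (s : ℝ) : Fin (m + 1) → ℝ :=
  fun k => s ^ (m - (k : ℕ)) / ((m - (k : ℕ))! : ℝ)

/-- The Weyl chamber `0 ≤ σ_1 ≤ … ≤ σ_{n-1} ≤ t` in `ℝ^(n-1)`. -/
def weylChamber (m : ℕ) (t : ℝ) : Set (Fin m → ℝ) :=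
  {σ | Monotone σ ∧ ∀ i, σ i ∈ Icc 0 t}

/-- The half-width of the input range. -/
def mu (uMin uMax : ℝ → ℝ) (s : ℝ) : ℝ := (uMax s - uMin s) / 2

/-- The midpoint of the input range. -/
def nu (uMin uMax : ℝ → ℝ) (s : ℝ) : ℝ := (uMax s + uMin s) / 2

/-- The list of points `0, σ_1, …, σ_{n-1}, t`. -/
def knots {m : ℕ} (t : ℝ) (σ : Fin m → ℝ) : Fin (m + 2) → ℝ :=
  Fin.cons 0 (Fin.snoc σ t : Fin (m + 1) → ℝ)

/-- The parametric point with leading sign `ε`: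
`χ(t, x₀) + ∫_0^t ν ξ(t-s) ds + ε (∫_0^{σ_1} - ∫_{σ_1}^{σ_2} + … + (-1)^(n-1) ∫_{σ_{n-1}}^t) μ ξ(t-s) ds`.
-/
def boundaryPoint {m : ℕ} (t : ℝ) (x₀ : Fin (m + 1) → ℝ) (uMin uMax : ℝ → ℝ) (ε : ℝ)
    (σ : Fin m → ℝ) : Fin (m + 1) → ℝ :=
  chi t x₀ + (∫ s in (0 : ℝ)..t, nu uMin uMax s • xi m (t - s))
    + ε • ∑ k : Fin (m + 1), (-1 : ℝ) ^ (k : ℕ) •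
        ∫ s in (knots t σ k.castSucc)..(knots t σ k.succ), mu uMin uMax s • xi m (t - s)

/-! ### The input range induced by a controllable single-input LTI system `ż = A z + b v` -/

/-- The controllability matrix `(b, A b, …, A^(n-1) b)`. -/
def ctrb {m : ℕ} (A : Matrix (Fin (m + 1)) (Fin (m + 1)) ℝ) (b : Fin (m + 1) → ℝ) :
    Matrix (Fin (m + 1)) (Fin (m + 1)) ℝ :=
  Matrix.of fun i j => ((A ^ (j : ℕ)) *ᵥ b) i

/-- The pair `(A, b)` is controllable: its controllability matrix has full rank. -/
def IsControllable {m : ℕ} (A : Matrix (Fin (m + 1)) (Fin (m + 1)) ℝ) (b : Fin (m + 1) → ℝ) :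
    Prop :=
  (ctrb A b).rank = m + 1

/-- The matrix with rows `qᵀ, qᵀ A, …, qᵀ A^(n-1)`, where `qᵀ` is the last row of the inverse of the
controllability matrix. -/
def toCanonical {m : ℕ} (A : Matrix (Fin (m + 1)) (Fin (m + 1)) ℝ) (b : Fin (m + 1) → ℝ) :
    Matrix (Fin (m + 1)) (Fin (m + 1)) ℝ :=
  Matrix.of fun i => (ctrb A b)⁻¹ (Fin.last m) ᵥ* (A ^ (i : ℕ))

/-- The coefficients `(c_0, …, c_{n-1})` of the monic characteristic polynomial of `A`. -/
def charCoeffs {m : ℕ} (A : Matrix (Fin (m + 1)) (Fin (m + 1)) ℝ) : Fin (m + 1) → ℝ :=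
  fun i => A.charpoly.coeff (i : ℕ)

/-- The companion matrix: ones on the superdiagonal and last row `-cᵀ`. -/
def aCon {m : ℕ} (A : Matrix (Fin (m + 1)) (Fin (m + 1)) ℝ) :
    Matrix (Fin (m + 1)) (Fin (m + 1)) ℝ :=
  Matrix.of fun i j =>
    if i = Fin.last m then -charCoeffs A j else if (j : ℕ) = (i : ℕ) + 1 then 1 else 0

/-- `f(τ) = ⟨c, e^{(s-τ) A_con} b_con⟩`. -/
def kernelF {m : ℕ} (A : Matrix (Fin (m + 1)) (Fin (m + 1)) ℝ) (s τ : ℝ) : ℝ :=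
  charCoeffs A ⬝ᵥ (NormedSpace.exp ((s - τ) • aCon A) *ᵥ bCon m)

/-- The zero sublevel set of `f` over `[0, s]`. -/
def subLevel {m : ℕ} (A : Matrix (Fin (m + 1)) (Fin (m + 1)) ℝ) (s : ℝ) : Set ℝ :=
  {τ ∈ Icc 0 s | kernelF A s τ ≤ 0}

/-- The strict zero superlevel set of `f` over `[0, s]`. -/
def superLevel {m : ℕ} (A : Matrix (Fin (m + 1)) (Fin (m + 1)) ℝ) (s : ℝ) : Set ℝ :=
  {τ ∈ Icc 0 s | 0 < kernelF A s τ}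

def iMin {m : ℕ} (A : Matrix (Fin (m + 1)) (Fin (m + 1)) ℝ) (vMin vMax s : ℝ) : ℝ :=
  vMin - vMin * (∫ τ in subLevel A s, kernelF A s τ)
    - vMax * (∫ τ in superLevel A s, kernelF A s τ)

def iMax {m : ℕ} (A : Matrix (Fin (m + 1)) (Fin (m + 1)) ℝ) (vMin vMax s : ℝ) : ℝ :=
  vMax - vMax * (∫ τ in subLevel A s, kernelF A s τ)
    - vMin * (∫ τ in superLevel A s, kernelF A s τ)

/-- The lower end of the input range of the integrator in the coordinates `x = M z`. -/
def uMinLTI {m : ℕ} (A : Matrix (Fin (m + 1)) (Fin (m + 1)) ℝ) (b z₀ : Fin (m + 1) → ℝ)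
    (vMin vMax s : ℝ) : ℝ :=
  -(charCoeffs A ⬝ᵥ (NormedSpace.exp (s • aCon A) *ᵥ (toCanonical A b *ᵥ z₀)))
    + iMin A vMin vMax s

/-- The upper end of the input range of the integrator in the coordinates `x = M z`. -/
def uMaxLTI {m : ℕ} (A : Matrix (Fin (m + 1)) (Fin (m + 1)) ℝ) (b z₀ : Fin (m + 1) → ℝ)
    (vMin vMax s : ℝ) : ℝ :=
  -(charCoeffs A ⬝ᵥ (NormedSpace.exp (s • aCon A) *ᵥ (toCanonical A b *ᵥ z₀)))
    + iMax A vMin vMax s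

end

end LTIReach

/-!
By variation of constants the reach set is the translate by `χ(t, x₀)` of the set of values
`∫ u(s) ξ(t - s) ds` over continuous inputs `u` between the bounds.  This set is convex, so each of
its frontier points `y` maximises some nonzero functional `f` over it.  A functional `f` is
maximised pointwise by the bang-bang input whose value is selected by the sign of `f(ξ(t - s))`;
this input is an `L¹`-limit of admissible continuous ones, so its value lies in the closure.  Since
moreover `f(ξ(t - s)) ≠ 0` for almost all `s`, inputs whose values nearly maximise `f` converge in
`L¹` to the bang-bang input, so `y` is the bang-bang value.

Finally, `f ↦ f ∘ ξ` identifies the nonzero functionals with the nonzero polynomials of degree at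
most `n - 1`.  On `[0, t)` the sign of such a polynomial in `t - s` is that of `± ∏ i, (σ i - s)`
for some `σ` in the Weyl chamber (pad the list of its roots in `s` with `t`), and every such product
occurs.
-/

namespace LTIReach

open Filter
open scoped Topology

section ConvexSupport

variable {E : Type*} [NormedAddCommGroup E] [NormedSpace ℝ E] {C : Set E} {y : E}

theorem exists_dual_const_of_interior_eq_empty [FiniteDimensional ℝ E] (hC : Convex ℝ C)
    (hint : interior C = ∅) {c : E} (hc : c ∈ C) :
    ∃ f : StrongDual ℝ E, f ≠ 0 ∧ ∀ a ∈ C, f a = f c := by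
  have hcs : c ∈ affineSpan ℝ C := subset_affineSpan ℝ C hc
  have hspan : (affineSpan ℝ C).direction ≠ ⊤ := by
    rw [Ne, AffineSubspace.direction_eq_top_iff_of_nonempty ⟨c, hcs⟩,
      ← hC.interior_nonempty_iff_affineSpan_eq_top, hint]
    exact not_nonempty_empty
  obtain ⟨ψ, hψ, hker⟩ := Submodule.exists_le_ker_of_lt_top _ hspan.lt_top
  refine ⟨LinearMap.toContinuousLinearMap ψ, by simpa using hψ, fun a ha => ?_⟩
  have hdiff : ψ (a - c) = 0 :=
    hker (AffineSubspace.vsub_mem_direction (subset_affineSpan ℝ C ha) hcs)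
  simpa [sub_eq_zero] using hdiff

theorem exists_dual_forall_le_of_mem_frontier [FiniteDimensional ℝ E] (hC : Convex ℝ C)
    (hy : y ∈ frontier C) : ∃ f : StrongDual ℝ E, f ≠ 0 ∧ ∀ a ∈ C, f a ≤ f y := by
  rcases (interior C).eq_empty_or_nonempty with hint | hint
  · obtain ⟨c, hc⟩ : C.Nonempty := closure_nonempty_iff.1 ⟨y, hy.1⟩
    obtain ⟨f, hf, hconst⟩ := exists_dual_const_of_interior_eq_empty hC hint hc
    have hfy : f y = f c := closure_minimal hconst (isClosed_singleton.preimage f.continuous) hy.1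
    exact ⟨f, hf, fun a ha => (hconst a ha).trans hfy.symm |>.le⟩
  · exact geometric_hahn_banach_of_nonempty_interior_point hC hy.2 hint

theorem notMem_interior_of_forall_dual_le {f : StrongDual ℝ E} (hf : f ≠ 0)
    (hy : ∀ a ∈ C, f a ≤ f y) : y ∉ interior C := fun h =>
  have hmax : IsLocalMax f y := mem_of_superset (mem_interior_iff_mem_nhds.1 h) hy
  hf (hmax.hasFDerivAt_eq_zero f.hasFDerivAt)

end ConvexSupport

section WeightedL1

variable {X ι : Type*} [MeasurableSpace X] {μ : Measure X} {g B : X → ℝ}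

theorem le_inv_mul_add_mul_div {d g b δ : ℝ} (hd : 0 ≤ d) (hdb : d ≤ b) (hg : 0 ≤ g)
    (hδ : 0 < δ) : d ≤ δ⁻¹ * (d * g) + b * (δ / (g + δ)) := by
  have hsplit : d = d * g / (g + δ) + d * (δ / (g + δ)) := by field_simp
  have hleft : d * g / (g + δ) ≤ δ⁻¹ * (d * g) := by
    rw [div_eq_inv_mul]
    gcongr
    linarith
  have hright : d * (δ / (g + δ)) ≤ b * (δ / (g + δ)) := by gcongr
  linarith

theorem div_abs_add_mem_Icc (g : ℝ) {δ : ℝ} (hδ : 0 < δ) : δ / (|g| + δ) ∈ Icc (0 : ℝ) 1 :=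
  ⟨by positivity, (div_le_one (by positivity)).2 (le_add_of_nonneg_left (abs_nonneg g))⟩

theorem aestronglyMeasurable_div_abs_add (hg : AEStronglyMeasurable g μ) (δ : ℝ) :
    AEStronglyMeasurable (fun x => δ / (|g x| + δ)) μ :=
  (aemeasurable_const.div (hg.aemeasurable.abs.add_const δ)).aestronglyMeasurable

theorem integrable_mul_div_abs_add (hB : Integrable B μ) (hg : AEStronglyMeasurable g μ)
    {δ : ℝ} (hδ : 0 < δ) : Integrable (fun x => B x * (δ / (|g x| + δ))) μ :=
  hB.mul_bdd (c := 1) (aestronglyMeasurable_div_abs_add hg δ) <| .of_forall fun x => by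
    rw [Real.norm_of_nonneg (div_abs_add_mem_Icc (g x) hδ).1]
    exact (div_abs_add_mem_Icc (g x) hδ).2

theorem tendsto_integral_mul_div_abs_add (hB : Integrable B μ) (hg : AEStronglyMeasurable g μ)
    (hne : ∀ᵐ x ∂μ, g x ≠ 0) :
    Tendsto (fun δ : ℝ => ∫ x, B x * (δ / (|g x| + δ)) ∂μ) (𝓝[>] 0)
      (𝓝 0) := by
  suffices h : Tendsto (fun δ : ℝ => ∫ x, B x * (δ / (|g x| + δ)) ∂μ)
      (𝓝[>] 0) (𝓝 (∫ _, 0 ∂μ)) by simpa using h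
  refine tendsto_integral_filter_of_dominated_convergence (fun x => |B x|) ?_ ?_ hB.abs ?_
  · exact .of_forall fun δ => hB.1.mul (aestronglyMeasurable_div_abs_add hg δ)
  · filter_upwards [self_mem_nhdsWithin] with δ hδ
    refine .of_forall fun x => ?_
    have hquot := div_abs_add_mem_Icc (g x) (mem_Ioi.1 hδ)
    rw [norm_mul, Real.norm_of_nonneg hquot.1]
    exact mul_le_of_le_one_right (abs_nonneg _) hquot.2
  · filter_upwards [hne] with x hx
    have hcont : ContinuousAt (fun δ : ℝ => B x * (δ / (|g x| + δ))) 0 :=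
      continuousAt_const.mul (.div (by fun_prop) (by fun_prop) (by simpa using hx))
    simpa using hcont.tendsto.mono_left (nhdsWithin_le_nhds (s := Ioi 0))

theorem tendsto_integral_abs_of_tendsto_integral_abs_mul_abs {l : Filter ι} {d : ι → X → ℝ}
    (hB : Integrable B μ) (hg : AEStronglyMeasurable g μ) (hne : ∀ᵐ x ∂μ, g x ≠ 0)
    (hd : ∀ i, Integrable (d i) μ) (hdg : ∀ i, Integrable (fun x => |d i x| * |g x|) μ)
    (hdB : ∀ i, ∀ᵐ x ∂μ, |d i x| ≤ B x)
    (hlim : Tendsto (fun i => ∫ x, |d i x| * |g x| ∂μ) l (𝓝 0)) :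
    Tendsto (fun i => ∫ x, |d i x| ∂μ) l (𝓝 0) := by
  have hsplit : ∀ i, ∀ δ > 0, ∫ x, |d i x| ∂μ ≤
      δ⁻¹ * ∫ x, |d i x| * |g x| ∂μ + ∫ x, B x * (δ / (|g x| + δ)) ∂μ := fun i δ hδ => by
    have hrest := integrable_mul_div_abs_add hB hg hδ
    rw [← integral_const_mul, ← integral_add ((hdg i).const_mul _) hrest]
    refine integral_mono_ae (hd i).abs (((hdg i).const_mul _).add hrest) ?_
    filter_upwards [hdB i] with x hx
    exact le_inv_mul_add_mul_div (abs_nonneg _) hx (abs_nonneg _) hδ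
  refine tendsto_order.2 ⟨fun a ha => .of_forall fun i =>
    ha.trans_le (integral_nonneg fun x => abs_nonneg _), fun ε hε => ?_⟩
  have hsmall := (tendsto_integral_mul_div_abs_add hB hg hne).eventually_lt_const (half_pos hε)
  obtain ⟨δ, hrest, hδ : 0 < δ⟩ := (hsmall.and self_mem_nhdsWithin).exists
  have hmain := (hlim.const_mul δ⁻¹).eventually_lt_const (u := ε / 2) (by simpa using hε)
  filter_upwards [hmain] with i hi
  linarith [hsplit i δ hδ]

end WeightedL1

noncomputable section

section BangBangValue

/-- The value in `[lo, hi]` that maximises `v ↦ v * g`: the end of the interval selected by the sign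
of `g`, and the midpoint of the interval when `g = 0`. -/
def bangBang (lo hi g : ℝ) : ℝ := (hi + lo) / 2 + (hi - lo) / 2 * (SignType.sign g : ℝ)

variable {lo hi g v : ℝ}

theorem bangBang_mem_Icc (h : lo ≤ hi) (g : ℝ) : bangBang lo hi g ∈ Icc lo hi := by
  rcases lt_trichotomy g 0 with hg | rfl | hg <;>
    constructor <;> simp [bangBang, *] <;> linarith

theorem bangBang_sub_mul (hv : v ∈ Icc lo hi) :
    (bangBang lo hi g - v) * g = |bangBang lo hi g - v| * |g| := by
  rw [← abs_mul]
  refine (abs_of_nonneg ?_).symm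
  rcases lt_trichotomy g 0 with hg | rfl | hg
  · refine mul_nonneg_of_nonpos_of_nonpos ?_ hg.le
    simp only [bangBang, sign_neg hg, SignType.coe_neg_one]
    linarith [hv.1]
  · simp
  · refine mul_nonneg ?_ hg.le
    simp only [bangBang, sign_pos hg, SignType.coe_one]
    linarith [hv.2]

theorem measurable_coe_sign : Measurable fun g : ℝ => (SignType.sign g : ℝ) := by
  simp only [sign_apply, apply_ite (fun s : SignType => (s : ℝ))]
  exact .ite measurableSet_Ioi measurable_const (.ite measurableSet_Iio measurable_const
    measurable_const)

end BangBangValue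

/-- `lo` and `hi` are continuous bounds on `K` that enclose a nonempty interval at each point. -/
structure IsInputRange {X : Type*} [TopologicalSpace X] (K : Set X) (lo hi : X → ℝ) : Prop where
  continuousOn_lo : ContinuousOn lo K
  continuousOn_hi : ContinuousOn hi K
  lo_le_hi : ∀ x ∈ K, lo x ≤ hi x

theorem IsInputRange.mono {X : Type*} [TopologicalSpace X] {K L : Set X} {lo hi : X → ℝ}
    (h : IsInputRange L lo hi) (hKL : K ⊆ L) : IsInputRange K lo hi :=
  ⟨h.continuousOn_lo.mono hKL, h.continuousOn_hi.mono hKL, fun x hx => h.lo_le_hi x (hKL hx)⟩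

/-- The values `∫ x in K, u x • F x` over all inputs `u` that are continuous on `K` and respect the
bounds `lo ≤ u ≤ hi` there. -/
def attainableSet {X E : Type*} [TopologicalSpace X] [MeasurableSpace X] [NormedAddCommGroup E]
    [NormedSpace ℝ E] (μ : Measure X) (K : Set X) (F : X → E) (lo hi : X → ℝ) : Set E :=
  {p | ∃ u : X → ℝ, ContinuousOn u K ∧ (∀ x ∈ K, u x ∈ Icc (lo x) (hi x)) ∧
    ∫ x in K, u x • F x ∂μ = p}

/-- The value attained by the input that maximises the functional `f` pointwise on `K`. -/
def bangBangPoint {X E : Type*} [MeasurableSpace X] [NormedAddCommGroup E]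
    [NormedSpace ℝ E] (μ : Measure X) (K : Set X) (F : X → E) (lo hi : X → ℝ)
    (f : StrongDual ℝ E) : E :=
  ∫ x in K, bangBang (lo x) (hi x) (f (F x)) • F x ∂μ

section AttainableSet

variable {X E : Type*} [TopologicalSpace X] [T2Space X] [MeasurableSpace X] [BorelSpace X]
  [NormedAddCommGroup E] [NormedSpace ℝ E] [SecondCountableTopologyEither X E]
  {μ : Measure X} {K : Set X} {F : X → E} {lo hi u v w : X → ℝ}
  {f : StrongDual ℝ E}

theorem IsInputRange.aestronglyMeasurable_bangBang (h : IsInputRange K lo hi) (hK : IsCompact K)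
    {g : X → ℝ} (hg : ContinuousOn g K) :
    AEStronglyMeasurable (fun x => bangBang (lo x) (hi x) (g x)) (μ.restrict K) := by
  have hlo := h.continuousOn_lo.aemeasurable (μ := μ) hK.measurableSet
  have hhi := h.continuousOn_hi.aemeasurable (μ := μ) hK.measurableSet
  have hsign := measurable_coe_sign.comp_aemeasurable (hg.aemeasurable (μ := μ) hK.measurableSet)
  exact (((hhi.add hlo).div_const 2).add
    (((hhi.sub hlo).div_const 2).mul hsign)).aestronglyMeasurable

theorem norm_setIntegral_smul_sub_le (hK : IsCompact K) (hF : ContinuousOn F K) {C : ℝ}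
    (hC : ∀ x ∈ K, ‖F x‖ ≤ C) (hv : IntegrableOn v K μ) (hw : IntegrableOn w K μ) :
    ‖∫ x in K, v x • F x ∂μ - ∫ x in K, w x • F x ∂μ‖ ≤ C * ∫ x in K, |v x - w x| ∂μ := by
  rw [← integral_sub (hv.smul_continuousOn hF hK) (hw.smul_continuousOn hF hK),
    ← integral_const_mul]
  refine norm_integral_le_of_norm_le ((hv.sub hw).abs.const_mul C) ?_
  filter_upwards [ae_restrict_mem hK.measurableSet] with x hx
  rw [← sub_smul, norm_smul, Real.norm_eq_abs, mul_comm]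
  exact mul_le_mul_of_nonneg_right (hC x hx) (abs_nonneg _)

variable [IsFiniteMeasureOnCompacts μ]

theorem IsInputRange.integrableOn (h : IsInputRange K lo hi) (hK : IsCompact K)
    (hw : AEStronglyMeasurable w (μ.restrict K)) (hmem : ∀ x ∈ K, w x ∈ Icc (lo x) (hi x)) :
    IntegrableOn w K μ :=
  integrable_of_le_of_le hw
    ((ae_restrict_mem hK.measurableSet).mono fun x hx => (hmem x hx).1)
    ((ae_restrict_mem hK.measurableSet).mono fun x hx => (hmem x hx).2)
    (h.continuousOn_lo.integrableOn_compact hK) (h.continuousOn_hi.integrableOn_compact hK)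

theorem exists_continuousOn_setIntegral_abs_sub_le [NormalSpace X] [μ.WeaklyRegular]
    (h : IsInputRange K lo hi) (hK : IsCompact K) (hw : AEStronglyMeasurable w (μ.restrict K))
    (hmem : ∀ x ∈ K, w x ∈ Icc (lo x) (hi x)) {δ : ℝ} (hδ : 0 < δ) :
    ∃ u, ContinuousOn u K ∧ (∀ x ∈ K, u x ∈ Icc (lo x) (hi x)) ∧
      ∫ x in K, |u x - w x| ∂μ ≤ δ := by
  have : (μ.restrict K).WeaklyRegular := .restrict_of_measure_ne_top hK.measure_lt_top.ne
  have hw_int := h.integrableOn hK hw hmem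
  obtain ⟨v, hv_le, hv⟩ := hw_int.exists_boundedContinuous_integral_sub_le hδ
  let u x := max (lo x) (min (hi x) (v x))
  have hu : ContinuousOn u K :=
    h.continuousOn_lo.sup (h.continuousOn_hi.inf v.continuous.continuousOn)
  refine ⟨u, hu, fun x hx => ⟨le_max_left _ _, max_le (h.lo_le_hi x hx) (min_le_left _ _)⟩,
    le_trans ?_ hv_le⟩
  refine setIntegral_mono_on ((hu.integrableOn_compact hK).sub hw_int).abs (hw_int.sub hv).norm
    hK.measurableSet fun x hx => ?_
  have hclamp := abs_projIcc_sub_projIcc (h.lo_le_hi x hx) (c := v x) (d := w x)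
  rwa [projIcc_of_mem _ (hmem x hx), coe_projIcc, abs_sub_comm (v x)] at hclamp

theorem setIntegral_smul_mem_closure_attainableSet [NormalSpace X] [μ.WeaklyRegular]
    (h : IsInputRange K lo hi) (hK : IsCompact K) (hF : ContinuousOn F K)
    (hw : AEStronglyMeasurable w (μ.restrict K)) (hmem : ∀ x ∈ K, w x ∈ Icc (lo x) (hi x)) :
    ∫ x in K, w x • F x ∂μ ∈ closure (attainableSet μ K F lo hi) := by
  obtain ⟨C, hC⟩ := hK.exists_bound_of_continuousOn hF
  refine Metric.mem_closure_iff.2 fun ε hε => ?_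
  obtain ⟨u, hu, hu_mem, hu_le⟩ := exists_continuousOn_setIntegral_abs_sub_le h hK hw hmem
    (show 0 < ε / (2 * (|C| + 1)) by positivity)
  refine ⟨_, ⟨u, hu, hu_mem, rfl⟩, ?_⟩
  rw [dist_comm, dist_eq_norm]
  calc ‖∫ x in K, u x • F x ∂μ - ∫ x in K, w x • F x ∂μ‖
      ≤ (|C| + 1) * ∫ x in K, |u x - w x| ∂μ :=
        norm_setIntegral_smul_sub_le hK hF
          (fun x hx => by linarith [hC x hx, le_abs_self C])
          (hu.integrableOn_compact hK) (h.integrableOn hK hw hmem)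
    _ ≤ (|C| + 1) * (ε / (2 * (|C| + 1))) := by gcongr
    _ = ε / 2 := by field_simp
    _ < ε := half_lt_self hε

theorem convex_attainableSet (hK : IsCompact K) (hF : ContinuousOn F K) :
    Convex ℝ (attainableSet μ K F lo hi) := by
  rintro _ ⟨v, hv, hv_mem, rfl⟩ _ ⟨w, hw, hw_mem, rfl⟩ a b ha hb hab
  refine ⟨fun x => a * v x + b * w x, (hv.const_mul a).add (hw.const_mul b),
    fun x hx => convex_Icc _ _ (hv_mem x hx) (hw_mem x hx) ha hb hab, ?_⟩
  have hvF := (hv.integrableOn_compact hK).smul_continuousOn hF hK (μ := μ)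
  have hwF := (hw.integrableOn_compact hK).smul_continuousOn hF hK (μ := μ)
  simp only [add_smul, mul_smul]
  rw [← integral_smul, ← integral_smul]
  exact integral_add (hvF.smul a) (hwF.smul b)

theorem IsInputRange.integrableOn_bangBang (h : IsInputRange K lo hi) (hK : IsCompact K)
    {g : X → ℝ} (hg : ContinuousOn g K) :
    IntegrableOn (fun x => bangBang (lo x) (hi x) (g x)) K μ :=
  h.integrableOn hK (h.aestronglyMeasurable_bangBang hK hg) fun x hx =>
    bangBang_mem_Icc (h.lo_le_hi x hx) _

theorem bangBangPoint_mem_closure_attainableSet [NormalSpace X] [μ.WeaklyRegular]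
    (h : IsInputRange K lo hi) (hK : IsCompact K) (hF : ContinuousOn F K) (f : StrongDual ℝ E) :
    bangBangPoint μ K F lo hi f ∈ closure (attainableSet μ K F lo hi) :=
  setIntegral_smul_mem_closure_attainableSet h hK hF
    (h.aestronglyMeasurable_bangBang hK (f.continuous.comp_continuousOn hF))
    fun x hx => bangBang_mem_Icc (h.lo_le_hi x hx) _

section CompleteSpace

variable [CompleteSpace E]

theorem dual_bangBangPoint_sub (h : IsInputRange K lo hi) (hK : IsCompact K)
    (hF : ContinuousOn F K) (f : StrongDual ℝ E) (hu : ContinuousOn u K)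
    (hu_mem : ∀ x ∈ K, u x ∈ Icc (lo x) (hi x)) :
    f (bangBangPoint μ K F lo hi f) - f (∫ x in K, u x • F x ∂μ) =
      ∫ x in K, |bangBang (lo x) (hi x) (f (F x)) - u x| * |f (F x)| ∂μ := by
  have hfF : ContinuousOn (fun x => f (F x)) K := f.continuous.comp_continuousOn hF
  have hbbF := (h.integrableOn_bangBang hK hfF (μ := μ)).smul_continuousOn hF hK
  have huF := (hu.integrableOn_compact hK).smul_continuousOn hF hK (μ := μ)
  rw [bangBangPoint, ← map_sub, ← integral_sub hbbF huF]
  refine (f.integral_comp_comm (hbbF.sub huF)).symm.trans ?_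
  refine setIntegral_congr_fun hK.measurableSet fun x hx => ?_
  simp only [Pi.sub_apply, ← sub_smul, map_smul, smul_eq_mul]
  exact bangBang_sub_mul (hu_mem x hx)

theorem dual_le_dual_bangBangPoint (h : IsInputRange K lo hi) (hK : IsCompact K)
    (hF : ContinuousOn F K) (f : StrongDual ℝ E) {p : E} (hp : p ∈ attainableSet μ K F lo hi) :
    f p ≤ f (bangBangPoint μ K F lo hi f) := by
  obtain ⟨u, hu, hu_mem, rfl⟩ := hp
  rw [← sub_nonneg, dual_bangBangPoint_sub h hK hF f hu hu_mem]
  exact integral_nonneg fun x => by positivity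

theorem tendsto_bangBangPoint_of_tendsto_dual {ι : Type*} {l : Filter ι} {u : ι → X → ℝ}
    (h : IsInputRange K lo hi) (hK : IsCompact K) (hF : ContinuousOn F K)
    (hne : ∀ᵐ x ∂μ.restrict K, f (F x) ≠ 0) (hu : ∀ i, ContinuousOn (u i) K)
    (hu_mem : ∀ i, ∀ x ∈ K, u i x ∈ Icc (lo x) (hi x))
    (hlim : Tendsto (fun i => f (∫ x in K, u i x • F x ∂μ)) l
      (𝓝 (f (bangBangPoint μ K F lo hi f)))) :
    Tendsto (fun i => ∫ x in K, u i x • F x ∂μ) l (𝓝 (bangBangPoint μ K F lo hi f)) := by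
  have hfF : ContinuousOn (fun x => f (F x)) K := f.continuous.comp_continuousOn hF
  let b x := bangBang (lo x) (hi x) (f (F x))
  have hb : IntegrableOn b K μ := h.integrableOn_bangBang hK hfF
  have hb_sub i : IntegrableOn (fun x => b x - u i x) K μ :=
    hb.sub ((hu i).integrableOn_compact hK)
  have hgap : Tendsto (fun i => ∫ x in K, |b x - u i x| * |f (F x)| ∂μ) l (𝓝 0) := by
    simp only [b, ← dual_bangBangPoint_sub h hK hF f (hu _) (hu_mem _)]
    simpa using hlim.const_sub (f (bangBangPoint μ K F lo hi f))
  have hL1 := tendsto_integral_abs_of_tendsto_integral_abs_mul_abs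
    ((h.continuousOn_hi.sub h.continuousOn_lo).integrableOn_compact hK)
    (hfF.aestronglyMeasurable_of_isCompact hK hK.measurableSet) hne hb_sub
    (fun i => IntegrableOn.mul_continuousOn (hb_sub i).abs hfF.abs hK)
    (fun i => (ae_restrict_mem hK.measurableSet).mono fun x hx =>
      Real.dist_le_of_mem_Icc (bangBang_mem_Icc (h.lo_le_hi x hx) _) (hu_mem i x hx)) hgap
  obtain ⟨C, hC⟩ := hK.exists_bound_of_continuousOn hF
  refine tendsto_iff_norm_sub_tendsto_zero.2 <| squeeze_zero (fun i => norm_nonneg _)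
    (fun i => ?_) (by simpa using hL1.const_mul C)
  rw [norm_sub_rev]
  exact norm_setIntegral_smul_sub_le hK hF hC hb ((hu i).integrableOn_compact hK)

variable [NormalSpace X] [μ.WeaklyRegular]

theorem bangBangPoint_mem_frontier_attainableSet (h : IsInputRange K lo hi) (hK : IsCompact K)
    (hF : ContinuousOn F K) {f : StrongDual ℝ E} (hf : f ≠ 0) :
    bangBangPoint μ K F lo hi f ∈ frontier (attainableSet μ K F lo hi) :=
  ⟨bangBangPoint_mem_closure_attainableSet h hK hF f,
    notMem_interior_of_forall_dual_le hf fun _ => dual_le_dual_bangBangPoint h hK hF f⟩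

theorem eq_bangBangPoint_of_forall_dual_le (h : IsInputRange K lo hi) (hK : IsCompact K)
    (hF : ContinuousOn F K) {f : StrongDual ℝ E} (hne : ∀ᵐ x ∂μ.restrict K, f (F x) ≠ 0) {y : E}
    (hy : y ∈ closure (attainableSet μ K F lo hi))
    (hmax : ∀ p ∈ attainableSet μ K F lo hi, f p ≤ f y) :
    y = bangBangPoint μ K F lo hi f := by
  have hfy : f y = f (bangBangPoint μ K F lo hi f) := le_antisymm
    (closure_minimal (fun _ => dual_le_dual_bangBangPoint h hK hF f)
      (isClosed_Iic.preimage f.continuous) hy)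
    (closure_minimal hmax (isClosed_Iic.preimage f.continuous)
      (bangBangPoint_mem_closure_attainableSet h hK hF f))
  choose u hu hu_mem hu_int using fun p : attainableSet μ K F lo hi => p.2
  have := mem_closure_iff_comap_neBot.1 hy
  have hy_lim : Tendsto ((↑) : attainableSet μ K F lo hi → E)
      (comap (↑) (𝓝 y)) (𝓝 y) := tendsto_comap
  refine tendsto_nhds_unique hy_lim ?_
  simpa only [hu_int] using tendsto_bangBangPoint_of_tendsto_dual h hK hF hne hu hu_mem <| by
    simpa only [hu_int, hfy] using! (f.continuous.tendsto y).comp hy_lim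

end CompleteSpace

theorem frontier_attainableSet [FiniteDimensional ℝ E] [NormalSpace X] [μ.WeaklyRegular]
    (h : IsInputRange K lo hi) (hK : IsCompact K) (hF : ContinuousOn F K)
    (hne : ∀ f : StrongDual ℝ E, f ≠ 0 → ∀ᵐ x ∂μ.restrict K, f (F x) ≠ 0) :
    frontier (attainableSet μ K F lo hi) = bangBangPoint μ K F lo hi '' {f | f ≠ 0} := by
  have := FiniteDimensional.complete ℝ E
  refine Subset.antisymm (fun y hy => ?_) ?_
  · obtain ⟨f, hf, hmax⟩ :=
      exists_dual_forall_le_of_mem_frontier (convex_attainableSet hK hF) hy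
    exact ⟨f, hf, (eq_bangBangPoint_of_forall_dual_le h hK hF (hne f hf) hy.1 hmax).symm⟩
  · rintro _ ⟨f, hf, rfl⟩
    exact bangBangPoint_mem_frontier_attainableSet h hK hF hf

end AttainableSet
end

section VariationOfConstants

theorem continuous_exp_smul {𝔸 : Type*} [NormedRing 𝔸] [NormedAlgebra ℝ 𝔸] [CompleteSpace 𝔸]
    (a : 𝔸) : Continuous fun s : ℝ => NormedSpace.exp (s • a) :=
  continuous_iff_continuousAt.2 fun s => (hasDerivAt_exp_smul_const a s).continuousAt

variable {E : Type*} [NormedAddCommGroup E] [NormedSpace ℝ E] [CompleteSpace E] (A : E →L[ℝ] E)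
  {x g : ℝ → E}

theorem hasDerivWithinAt_exp_sub_smul_apply (t : ℝ) {s : ℝ} {S : Set ℝ} {y : E}
    (hx : HasDerivWithinAt x (A (x s) + y) S s) :
    HasDerivWithinAt (fun r => NormedSpace.exp ((t - r) • A) (x r))
      (NormedSpace.exp ((t - s) • A) y) S s := by
  have hexp := (hasDerivAt_exp_smul_const A (t - s)).comp_const_sub t s
  convert! hexp.hasDerivWithinAt.clm_apply hx using 1
  simp

theorem eq_exp_smul_add_integral {t : ℝ} (ht : 0 ≤ t) (hg : ContinuousOn g (Icc 0 t))
    (hx : ∀ s ∈ Icc 0 t, HasDerivWithinAt x (A (x s) + g s) (Icc 0 t) s) :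
    x t = NormedSpace.exp (t • A) (x 0) + ∫ s in 0..t, NormedSpace.exp ((t - s) • A) (g s) := by
  have hderiv s (hs : s ∈ Icc 0 t) := hasDerivWithinAt_exp_sub_smul_apply A t (hx s hs)
  have hint : ContinuousOn (fun s => NormedSpace.exp ((t - s) • A) (g s)) (Icc 0 t) :=
    ((continuous_exp_smul A).comp (continuous_const.sub continuous_id)).continuousOn.clm_apply hg
  have hftc := intervalIntegral.integral_eq_sub_of_hasDeriv_right_of_le ht
    (fun s hs => (hderiv s hs).continuousWithinAt)
    (fun s hs => ((hderiv s (Ioo_subset_Icc_self hs)).hasDerivAt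
      (Icc_mem_nhds hs.1 hs.2)).hasDerivWithinAt) (hint.intervalIntegrable_of_Icc ht)
  rw [hftc]
  simp

theorem exists_hasDerivAt_eq_apply_add (hg : Continuous g) (x₀ : E) :
    ∃ x : ℝ → E, x 0 = x₀ ∧ ∀ s, HasDerivAt x (A (x s) + g s) s := by
  have hint : Continuous fun s => NormedSpace.exp (s • -A) (g s) :=
    (continuous_exp_smul (-A)).clm_apply hg
  refine ⟨fun s => NormedSpace.exp (s • A) (x₀ + ∫ r in 0..s, NormedSpace.exp (r • -A) (g r)),
    by simp, fun s => ?_⟩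
  have hinv : NormedSpace.exp (s • A) * NormedSpace.exp (s • -A) = 1 := by
    let := NormedAlgebra.restrictScalars ℚ ℝ (E →L[ℝ] E)
    rw [← NormedSpace.exp_add_of_commute] <;> simp
  convert! (hasDerivAt_exp_smul_const' A s).clm_apply
    ((hint.integral_hasStrictDerivAt 0 s).hasDerivAt.const_add x₀) using 1
  rw [← mul_apply_eq_comp, ← mul_apply_eq_comp, hinv]
  simp

end VariationOfConstants

section Integrator

variable {m : ℕ} {t : ℝ} {lo hi : ℝ → ℝ}

theorem aInt_mulVec_castSucc (x : Fin (m + 1) → ℝ) (i : Fin m) :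
    (aInt m *ᵥ x) i.castSucc = x i.succ := by
  have hrow j : aInt m i.castSucc j = if j = i.succ then 1 else 0 := by
    simp [aInt, Fin.ext_iff]
  simp [Matrix.mulVec, dotProduct, hrow]

theorem aInt_mulVec_last (x : Fin (m + 1) → ℝ) : (aInt m *ᵥ x) (Fin.last m) = 0 := by
  have hrow j : aInt m (Fin.last m) j = 0 := by simp [aInt, j.isLt.ne]
  simp [Matrix.mulVec, dotProduct, hrow]

/-- The state matrix of the integrator as a continuous linear map, whose exponential is the flow of
the undriven system. -/
noncomputable abbrev aIntCLM (m : ℕ) : (Fin (m + 1) → ℝ) →L[ℝ] Fin (m + 1) → ℝ :=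
  LinearMap.toContinuousLinearMap (aInt m).mulVecLin

theorem chi_zero (x : Fin (m + 1) → ℝ) : chi 0 x = x := by
  funext k
  rw [chi, Finset.sum_eq_single k (fun l _ hlk => ?_) (by simp)]
  · simp
  · rw [ite_eq_right_iff]
    intro hkl
    have : (l : ℕ) - k ≠ 0 := by lia
    simp [this]

theorem chi_smul_bCon (r u : ℝ) : chi r (u • bCon m) = u • xi m r := by
  funext k
  rw [chi, Finset.sum_eq_single (Fin.last m) (fun l _ hl => by simp [bCon, hl]) (by simp)]
  simp [bCon, xi, Fin.le_last, mul_comm]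

theorem continuous_xi : Continuous (xi m) := by
  unfold xi
  fun_prop

theorem hasDerivAt_pow_div_factorial (r : ℝ) (j : ℕ) :
    HasDerivAt (fun r : ℝ => r ^ (j + 1) / ((j + 1)! : ℝ)) (r ^ j / (j ! : ℝ)) r := by
  refine ((hasDerivAt_pow (j + 1) r).div_const ((j + 1)! : ℝ)).congr_deriv ?_
  rw [Nat.factorial_succ]
  push_cast
  field_simp

theorem hasDerivAt_chi (x : Fin (m + 1) → ℝ) (r : ℝ) :
    HasDerivAt (chi · x) (aInt m *ᵥ chi r x) r := by
  refine hasDerivAt_pi.2 fun k => ?_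
  induction k using Fin.lastCases with
  | last =>
    rw [aInt_mulVec_last]
    refine (hasDerivAt_const r (x (Fin.last m))).congr_of_eventuallyEq (.of_forall fun r => ?_)
    simp [chi, Fin.last_le_iff]
  | cast i =>
    rw [aInt_mulVec_castSucc]
    refine HasDerivAt.fun_sum fun l _ => ?_
    rcases lt_trichotomy l i.castSucc with hl | rfl | hl
    · simpa [hl.not_ge, (hl.trans i.castSucc_lt_succ).not_ge] using hasDerivAt_const r (0 : ℝ)
    · simpa [i.castSucc_lt_succ.not_ge] using hasDerivAt_const r (x i.castSucc)
    · have hpow : (l : ℕ) - (i.castSucc : ℕ) = (l : ℕ) - (i.succ : ℕ) + 1 := by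
        have : (i : ℕ) < l := hl
        simp only [Fin.val_castSucc, Fin.val_succ]
        lia
      simp only [hl.le, Fin.castSucc_lt_iff_succ_le.1 hl, if_true, hpow]
      exact (hasDerivAt_pow_div_factorial r _).mul_const (x l)

theorem exp_smul_aInt_apply (r : ℝ) (x : Fin (m + 1) → ℝ) :
    NormedSpace.exp (r • aIntCLM m) x = chi r x := by
  have hderiv s :
      HasDerivAt (fun s => NormedSpace.exp ((r - s) • aIntCLM m) (chi s x)) 0 s := by
    simpa using hasDerivWithinAt_exp_sub_smul_apply (aIntCLM m) r (S := univ) (y := 0)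
      (by simpa using hasDerivAt_chi x s)
  simpa [chi_zero] using
    is_const_of_deriv_eq_zero (fun s => (hderiv s).differentiableAt) (fun s => (hderiv s).deriv) 0 r

theorem eq_chi_add_setIntegral (ht : 0 ≤ t) {u : ℝ → ℝ} {x : ℝ → Fin (m + 1) → ℝ}
    (hu : ContinuousOn u (Icc 0 t))
    (hx : ∀ s ∈ Icc 0 t, HasDerivWithinAt x (aInt m *ᵥ x s + u s • bCon m) (Icc 0 t) s) :
    x t = chi t (x 0) + ∫ s in Icc 0 t, u s • xi m (t - s) := by
  have hvar := eq_exp_smul_add_integral (aIntCLM m) ht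
    (g := fun s => u s • bCon m) (hu.smul continuousOn_const) hx
  simpa only [exp_smul_aInt_apply, chi_smul_bCon, intervalIntegral.integral_of_le ht,
    ← integral_Icc_eq_integral_Ioc] using hvar

theorem integratorReachSet_eq_image_attainableSet (ht : 0 ≤ t) (x₀ : Fin (m + 1) → ℝ) :
    integratorReachSet t x₀ lo hi =
      (chi t x₀ + ·) '' attainableSet volume (Icc 0 t) (fun s => xi m (t - s)) lo hi := by
  refine Subset.antisymm ?_ ?_
  · rintro _ ⟨u, x, hu, hu_mem, rfl, hx, rfl⟩
    exact ⟨_, ⟨u, hu, hu_mem, rfl⟩, (eq_chi_add_setIntegral ht hu hx).symm⟩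
  · rintro _ ⟨_, ⟨u, hu, hu_mem, rfl⟩, rfl⟩
    have hu_ext : Continuous (IccExtend ht ((Icc 0 t).domRestrict u)) :=
      hu.domRestrict.Icc_extend'
    obtain ⟨x, rfl, hx⟩ := exists_hasDerivAt_eq_apply_add (aIntCLM m)
      (hu_ext.smul (continuous_const (y := bCon m))) x₀
    have hx_Icc s (hs : s ∈ Icc 0 t) :
        HasDerivWithinAt x (aInt m *ᵥ x s + u s • bCon m) (Icc 0 t) s := by
      simpa [IccExtend_of_mem ht _ hs] using (hx s).hasDerivWithinAt (s := Icc 0 t)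
    exact ⟨u, x, hu, hu_mem, rfl, hx_Icc, eq_chi_add_setIntegral ht hu hx_Icc⟩

end Integrator

section SignPattern

variable {m : ℕ}

theorem exists_sign_eq_of_isPreconnected {X : Type*} [TopologicalSpace X] {S : Set X}
    (hS : IsPreconnected S) {f : X → ℝ} (hf : ContinuousOn f S) (hne : ∀ x ∈ S, f x ≠ 0) :
    ∃ ε : ℝ, (ε = 1 ∨ ε = -1) ∧ ∀ x ∈ S, SignType.sign (f x) = SignType.sign ε := by
  obtain rfl | ⟨y, hy⟩ := S.eq_empty_or_nonempty
  · exact ⟨1, Or.inl rfl, fun x hx => hx.elim⟩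
  have hconst : ∀ x ∈ S, SignType.sign (f x) = SignType.sign (f y) := fun x hx =>
    hS.constant (fun z hz =>
      (continuousAt_sign_of_ne_zero (hne z hz)).comp_continuousWithinAt (hf z hz)) hx hy
  obtain hneg | hpos := (hne y hy).lt_or_gt
  · exact ⟨-1, Or.inr rfl, fun x hx => by simp [hconst x hx, sign_neg hneg]⟩
  · exact ⟨1, Or.inl rfl, fun x hx => by simp [hconst x hx, sign_pos hpos]⟩

open Polynomial in
theorem exists_sign_eval_eq_sign_prod {a b : ℝ} (hab : a ≤ b) {q : ℝ[X]} (hq : q ≠ 0)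
    (hdeg : q.natDegree ≤ m) :
    ∃ ε : ℝ, (ε = 1 ∨ ε = -1) ∧ ∃ ρ : Fin m → ℝ, (∀ i, ρ i ∈ Icc a b) ∧
      ∀ r ∈ Ioc a b, SignType.sign (q.eval r) = SignType.sign (ε * ∏ i, (r - ρ i)) := by
  induction m generalizing q with
  | zero =>
    obtain ⟨c, rfl⟩ := natDegree_eq_zero.1 (Nat.le_zero.1 hdeg)
    obtain ⟨ε, hε, hsign⟩ := exists_sign_eq_of_isPreconnected isPreconnected_univ
      (continuousOn_const (c := c)) fun (_ : ℝ) _ => C_ne_zero.1 hq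
    exact ⟨ε, hε, Fin.elim0, fun i => i.elim0, fun r _ => by simpa using hsign r (mem_univ r)⟩
  | succ m ih =>
    by_cases hroot : ∃ r₀ ∈ Ioc a b, q.IsRoot r₀
    · obtain ⟨r₀, hr₀, hroot⟩ := hroot
      obtain ⟨p, rfl⟩ := dvd_iff_isRoot.2 hroot
      have hp : p ≠ 0 := right_ne_zero_of_mul hq
      rw [natDegree_mul (X_sub_C_ne_zero r₀) hp, natDegree_X_sub_C] at hdeg
      obtain ⟨ε, hε, ρ, hρ, hsign⟩ := ih hp (by lia)
      refine ⟨ε, hε, Fin.cons r₀ ρ, Fin.cases (Ioc_subset_Icc_self hr₀) hρ, fun r hr => ?_⟩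
      rw [eval_mul, sign_mul, hsign r hr, ← sign_mul, Fin.prod_univ_succ, mul_left_comm]
      simp
    · push Not at hroot
      obtain ⟨ε, hε, hsign⟩ := exists_sign_eq_of_isPreconnected isPreconnected_Ioc
        q.continuous.continuousOn hroot
      refine ⟨ε, hε, fun _ => a, fun _ => left_mem_Icc.2 hab, fun r hr => ?_⟩
      have hpos : 0 < ∏ _i : Fin (m + 1), (r - a) := Finset.prod_pos fun _ _ => sub_pos.2 hr.1
      rw [hsign r hr, sign_mul, sign_pos hpos, mul_one]

open Polynomial in
theorem exists_polynomial_eval_eq_dual_xi {f : StrongDual ℝ (Fin (m + 1) → ℝ)} (hf : f ≠ 0) :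
    ∃ q : ℝ[X], q ≠ 0 ∧ q.natDegree ≤ m ∧ ∀ r, f (xi m r) = q.eval r := by
  classical
  let η : Fin (m + 1) → ℝ := fun k => f (Pi.single k 1)
  have hη : ∀ x, f x = ∑ k, x k * η k := fun x => by
    conv_lhs => rw [pi_eq_sum_univ' x]
    simp [η]
  let q : ℝ[X] := ∑ k : Fin (m + 1), C (η k / ((m - (k : ℕ))! : ℝ)) * X ^ (m - (k : ℕ))
  have hcoeff : ∀ k : Fin (m + 1), q.coeff (m - (k : ℕ)) = η k / ((m - (k : ℕ))! : ℝ) := by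
    intro k
    have hinj : ∀ l : Fin (m + 1), m - (k : ℕ) = m - (l : ℕ) ↔ k = l := fun l => by lia
    simp [q, coeff_X_pow, hinj]
  refine ⟨q, fun hq => hf ?_, ?_, fun r => ?_⟩
  · have hη₀ : ∀ k, η k = 0 := fun k => by
      simpa [hq, Nat.factorial_ne_zero] using (hcoeff k).symm
    ext x
    simp [hη, hη₀]
  · exact natDegree_sum_le_of_forall_le _ _ fun k _ =>
      (natDegree_C_mul_X_pow_le _ _).trans (Nat.sub_le _ _)
  · rw [hη, eval_finsetSum]
    refine Finset.sum_congr rfl fun k _ => ?_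
    simp only [xi, eval_mul, eval_C, eval_pow, eval_X]
    ring

open Polynomial in
theorem exists_dual_xi_eq_polynomial_eval {q : ℝ[X]} (hq : q ≠ 0) (hdeg : q.natDegree ≤ m) :
    ∃ f : StrongDual ℝ (Fin (m + 1) → ℝ), f ≠ 0 ∧ ∀ r, f (xi m r) = q.eval r := by
  let f : StrongDual ℝ (Fin (m + 1) → ℝ) := ∑ k : Fin (m + 1),
    (((m - (k : ℕ))! : ℝ) * q.coeff (m - (k : ℕ))) • ContinuousLinearMap.proj (R := ℝ) k
  have hf : ∀ r, f (xi m r) = q.eval r := fun r => by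
    rw [eval_eq_sum_range' (Nat.lt_succ_of_le hdeg), ← Finset.sum_range_reflect,
      ← Fin.sum_univ_eq_sum_range (fun j => q.coeff (m + 1 - 1 - j) * r ^ (m + 1 - 1 - j))]
    simp only [f, sum_apply, smul_apply,
      ContinuousLinearMap.proj_apply, xi, smul_eq_mul, Nat.add_sub_cancel]
    refine Finset.sum_congr rfl fun k _ => ?_
    field_simp
  refine ⟨f, fun hf₀ => hq (Polynomial.funext fun r => ?_), hf⟩
  rw [← hf, hf₀]
  simp

theorem ae_dual_xi_sub_ne_zero {f : StrongDual ℝ (Fin (m + 1) → ℝ)} (hf : f ≠ 0) (t : ℝ) :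
    ∀ᵐ s : ℝ, f (xi m (t - s)) ≠ 0 := by
  obtain ⟨q, hq, -, hfq⟩ := exists_polynomial_eval_eq_dual_xi hf
  have hfin : {s : ℝ | q.IsRoot (t - s)}.Finite :=
    (Polynomial.finite_setOfPred_isRoot hq).preimage sub_right_injective.injOn
  filter_upwards [hfin.countable.ae_notMem volume] with s hs
  rw [hfq]
  exact hs

theorem exists_sign_dual_xi_eq_sign_prod {t : ℝ} (ht : 0 ≤ t)
    {f : StrongDual ℝ (Fin (m + 1) → ℝ)} (hf : f ≠ 0) :
    ∃ ε : ℝ, (ε = 1 ∨ ε = -1) ∧ ∃ σ ∈ weylChamber m t, ∀ s ∈ Ico 0 t,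
      SignType.sign (f (xi m (t - s))) = SignType.sign (ε * ∏ i, (σ i - s)) := by
  obtain ⟨q, hq, hdeg, hfq⟩ := exists_polynomial_eval_eq_dual_xi hf
  obtain ⟨ε, hε, ρ, hρ, hsign⟩ := exists_sign_eval_eq_sign_prod ht hq hdeg
  let σ : Fin m → ℝ := fun i => t - ρ i
  refine ⟨ε, hε, σ ∘ Tuple.sort σ, ⟨Tuple.monotone_sort σ, fun i => ?_⟩, fun s hs => ?_⟩
  · simpa [σ] using (hρ (Tuple.sort σ i)).symm
  · have hprod : ∏ i, ((σ ∘ Tuple.sort σ) i - s) = ∏ i, (t - s - ρ i) :=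
      (Equiv.prod_comp (Tuple.sort σ) fun i => σ i - s).trans
        (Finset.prod_congr rfl fun i _ => sub_right_comm t (ρ i) s)
    rw [hfq, hprod, hsign (t - s) ⟨sub_pos.2 hs.2, sub_le_self t hs.1⟩]

open Polynomial in
theorem exists_dual_xi_sub_eq_prod (t : ℝ) {ε : ℝ} (hε : ε ≠ 0) (σ : Fin m → ℝ) :
    ∃ f : StrongDual ℝ (Fin (m + 1) → ℝ), f ≠ 0 ∧
      ∀ s, f (xi m (t - s)) = ε * ∏ i, (σ i - s) := by
  have hmonic : ∀ i ∈ Finset.univ, (X - C (t - σ i)).Monic := fun i _ => monic_X_sub_C _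
  have hdeg : (C ε * ∏ i, (X - C (t - σ i))).natDegree ≤ m := by
    rw [natDegree_C_mul hε, natDegree_prod_of_monic _ _ hmonic]
    simp only [natDegree_X_sub_C, Finset.sum_const, Finset.card_univ, Fintype.card_fin,
      smul_eq_mul, mul_one, le_refl]
  obtain ⟨f, hf, hfq⟩ := exists_dual_xi_eq_polynomial_eval
    (mul_ne_zero (C_ne_zero.2 hε) (monic_prod_of_monic _ _ hmonic).ne_zero) hdeg
  exact ⟨f, hf, fun s => by simp [hfq, eval_prod]⟩

end SignPattern

section Knots

variable {m : ℕ} {t : ℝ} {σ : Fin m → ℝ}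

theorem knots_succ_castSucc (t : ℝ) (σ : Fin m → ℝ) (i : Fin m) :
    knots t σ i.castSucc.succ = σ i := by
  simp [knots]

theorem knots_last (t : ℝ) (σ : Fin m → ℝ) : knots t σ (Fin.last (m + 1)) = t := by
  simp [knots, ← Fin.succ_last]

theorem knots_mem_Icc (ht : 0 ≤ t) (hσ : σ ∈ weylChamber m t) (k : Fin (m + 2)) :
    knots t σ k ∈ Icc 0 t := by
  refine Fin.cases (left_mem_Icc.2 ht) (Fin.lastCases ?_ fun i => ?_) k
  · rw [Fin.succ_last, knots_last]
    exact right_mem_Icc.2 ht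
  · rw [knots_succ_castSucc]
    exact hσ.2 i

theorem monotone_knots (ht : 0 ≤ t) (hσ : σ ∈ weylChamber m t) : Monotone (knots t σ) := by
  refine Fin.monotone_iff_le_succ.2 (Fin.lastCases ?_ fun i => ?_)
  · rw [Fin.succ_last, knots_last]
    exact (knots_mem_Icc ht hσ _).2
  · rw [knots_succ_castSucc]
    cases m with
    | zero => exact i.elim0
    | succ m =>
      cases i using Fin.cases with
      | zero => exact (hσ.2 0).1
      | succ j =>
        rw [← Fin.succ_castSucc, ← Fin.succ_castSucc, knots_succ_castSucc]
        exact hσ.1 j.castSucc_le_succ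

theorem sign_prod_sub_eq_of_mem_Ioo (ht : 0 ≤ t) (hσ : σ ∈ weylChamber m t) (k : Fin (m + 1))
    {s : ℝ} (hs : s ∈ Ioo (knots t σ k.castSucc) (knots t σ k.succ)) :
    SignType.sign (∏ i, (σ i - s)) = (-1) ^ (k : ℕ) := by
  have hfactor : ∀ i : Fin m, SignType.sign (σ i - s) = if (i : ℕ) < k then -1 else 1 := by
    intro i
    rw [← knots_succ_castSucc t σ i]
    split_ifs with h
    · refine sign_neg (sub_neg.2 ((monotone_knots ht hσ ?_).trans_lt hs.1))
      simpa [Fin.le_def] using h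
    · refine sign_pos (sub_pos.2 (hs.2.trans_le (monotone_knots ht hσ ?_)))
      simpa [Fin.le_def] using h
  have hfilter : (Finset.range m).filter (· < (k : ℕ)) = Finset.range k := by
    ext i
    simp only [Finset.mem_filter, Finset.mem_range]
    lia
  calc SignType.sign (∏ i, (σ i - s))
      = ∏ i : Fin m, if (i : ℕ) < k then -1 else 1 := by
        rw [← signHom_apply, map_prod]
        exact Finset.prod_congr rfl fun i _ => hfactor i
    _ = (-1) ^ (k : ℕ) := by
        rw [Fin.prod_univ_eq_prod_range (fun i => if i < (k : ℕ) then (-1 : SignType) else 1) m,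
          Finset.prod_ite, hfilter]
        simp

theorem sum_integral_knots {E : Type*} [NormedAddCommGroup E] [NormedSpace ℝ E] {f : ℝ → E}
    (ht : 0 ≤ t) (hσ : σ ∈ weylChamber m t) (hf : IntervalIntegrable f volume 0 t) :
    ∑ k : Fin (m + 1), ∫ s in (knots t σ k.castSucc)..(knots t σ k.succ), f s =
      ∫ s in (0 : ℝ)..t, f s := by
  let a : ℕ → ℝ := fun j => knots t σ (Fin.ofNat (m + 2) j)
  have ha : ∀ k : Fin (m + 2), a k = knots t σ k := fun k =>
    congrArg (knots t σ) (Fin.ofNat_val_eq_self k)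
  have hint : ∀ j < m + 1, IntervalIntegrable f volume (a j) (a (j + 1)) := fun j _ =>
    hf.mono_set (uIcc_of_le ht ▸ uIcc_subset_Icc (knots_mem_Icc ht hσ _) (knots_mem_Icc ht hσ _))
  calc ∑ k : Fin (m + 1), ∫ s in (knots t σ k.castSucc)..(knots t σ k.succ), f s
      = ∑ k : Fin (m + 1), ∫ s in (a k)..(a (k + 1)), f s :=
        Finset.sum_congr rfl fun k _ => by rw [← ha k.castSucc, ← ha k.succ]; rfl
    _ = ∫ s in (a 0)..(a (m + 1)), f s := by
        rw [Fin.sum_univ_eq_sum_range fun j => ∫ s in (a j)..(a (j + 1)), f s,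
          intervalIntegral.sum_integral_adjacent_intervals hint]
    _ = ∫ s in (0 : ℝ)..t, f s := by
        have hlast : a (m + 1) = t := (ha (Fin.last _)).trans (knots_last t σ)
        rw [hlast, show a 0 = 0 from ha 0]

theorem intervalIntegrable_coe_sign_smul {E : Type*} [NormedAddCommGroup E] [NormedSpace ℝ E]
    {f : ℝ → E} {g : ℝ → ℝ} {a b : ℝ} (hf : IntervalIntegrable f volume a b)
    (hg : Measurable g) :
    IntervalIntegrable (fun s => (SignType.sign (g s) : ℝ) • f s) volume a b := by
  refine hf.norm.mono_fun' ((measurable_coe_sign.comp hg).aestronglyMeasurable.smul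
    hf.def'.aestronglyMeasurable) (Eventually.of_forall fun s => ?_)
  refine (norm_smul_le _ _).trans (mul_le_of_le_one_left (norm_nonneg _) ?_)
  cases SignType.sign (g s) <;> simp

theorem sum_neg_one_pow_smul_integral_knots {E : Type*} [NormedAddCommGroup E] [NormedSpace ℝ E]
    {f : ℝ → E} (ht : 0 ≤ t) (hσ : σ ∈ weylChamber m t) (hf : IntervalIntegrable f volume 0 t) :
    ∑ k : Fin (m + 1), (-1 : ℝ) ^ (k : ℕ) •
        ∫ s in (knots t σ k.castSucc)..(knots t σ k.succ), f s =
      ∫ s in (0 : ℝ)..t, (SignType.sign (∏ i, (σ i - s)) : ℝ) • f s := by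
  have hpiece : ∀ k : Fin (m + 1), (-1 : ℝ) ^ (k : ℕ) •
      ∫ s in (knots t σ k.castSucc)..(knots t σ k.succ), f s =
      ∫ s in (knots t σ k.castSucc)..(knots t σ k.succ),
        (SignType.sign (∏ i, (σ i - s)) : ℝ) • f s := by
    intro k
    have hle := monotone_knots ht hσ (Fin.castSucc_le_succ k)
    rw [← intervalIntegral.integral_smul, intervalIntegral.integral_of_le hle,
      intervalIntegral.integral_of_le hle, integral_Ioc_eq_integral_Ioo,
      integral_Ioc_eq_integral_Ioo]
    refine setIntegral_congr_fun measurableSet_Ioo fun s hs => ?_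
    simp [sign_prod_sub_eq_of_mem_Ioo ht hσ k hs]
  rw [Finset.sum_congr rfl fun k _ => hpiece k,
    sum_integral_knots ht hσ (intervalIntegrable_coe_sign_smul hf (by fun_prop))]

theorem boundaryPoint_eq_chi_add_setIntegral {x₀ : Fin (m + 1) → ℝ} {lo hi : ℝ → ℝ} {ε : ℝ}
    (ht : 0 ≤ t) (h : IsInputRange (Icc 0 t) lo hi) (hε : ε = 1 ∨ ε = -1)
    (hσ : σ ∈ weylChamber m t) :
    boundaryPoint t x₀ lo hi ε σ = chi t x₀ +
      ∫ s in Icc 0 t, bangBang (lo s) (hi s) (ε * ∏ i, (σ i - s)) • xi m (t - s) := by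
  have hξ : Continuous fun s => xi m (t - s) := continuous_xi.comp (by fun_prop)
  have hν : IntervalIntegrable (fun s => nu lo hi s • xi m (t - s)) volume 0 t :=
    (((h.continuousOn_hi.add h.continuousOn_lo).div_const 2).smul
      hξ.continuousOn).intervalIntegrable_of_Icc ht
  have hμ : IntervalIntegrable (fun s => mu lo hi s • xi m (t - s)) volume 0 t :=
    (((h.continuousOn_hi.sub h.continuousOn_lo).div_const 2).smul
      hξ.continuousOn).intervalIntegrable_of_Icc ht
  have hsign : ∀ g : ℝ, (SignType.sign (ε * g) : ℝ) = ε * (SignType.sign g : ℝ) := fun g => by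
    rcases hε with rfl | rfl <;> simp [Left.sign_neg]
  have hswitch : IntervalIntegrable
      (fun s => ε • (SignType.sign (∏ i, (σ i - s)) : ℝ) • mu lo hi s • xi m (t - s)) volume 0 t :=
    (intervalIntegrable_coe_sign_smul hμ (by fun_prop)).smul ε
  rw [boundaryPoint, sum_neg_one_pow_smul_integral_knots ht hσ hμ,
    ← intervalIntegral.integral_smul, add_assoc, ← intervalIntegral.integral_add hν hswitch,
    intervalIntegral.integral_of_le ht, integral_Icc_eq_integral_Ioc]
  congr 2 with s
  simp only [bangBang, hsign, nu, mu, add_smul, mul_smul, Pi.add_apply]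
  rw [smul_comm ((hi s - lo s) / 2), smul_comm ((hi s - lo s) / 2)]

end Knots

section Frontier

variable {m : ℕ} {t : ℝ} {lo hi : ℝ → ℝ}

theorem bangBangPoint_xi_eq_of_sign_eq {f : StrongDual ℝ (Fin (m + 1) → ℝ)} {g : ℝ → ℝ}
    (hfg : ∀ s ∈ Ico 0 t, SignType.sign (f (xi m (t - s))) = SignType.sign (g s)) :
    bangBangPoint volume (Icc 0 t) (fun s => xi m (t - s)) lo hi f =
      ∫ s in Icc 0 t, bangBang (lo s) (hi s) (g s) • xi m (t - s) := by
  rw [bangBangPoint, ← setIntegral_congr_set Ico_ae_eq_Icc, ← setIntegral_congr_set Ico_ae_eq_Icc]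
  exact setIntegral_congr_fun measurableSet_Ico fun s hs => by simp only [bangBang, hfg s hs]

theorem image_bangBangPoint_xi (ht : 0 ≤ t) (h : IsInputRange (Icc 0 t) lo hi)
    (x₀ : Fin (m + 1) → ℝ) :
    (chi t x₀ + ·) ''
        (bangBangPoint volume (Icc 0 t) (fun s => xi m (t - s)) lo hi '' {f | f ≠ 0}) =
      boundaryPoint t x₀ lo hi 1 '' weylChamber m t ∪
        boundaryPoint t x₀ lo hi (-1) '' weylChamber m t := by
  apply Subset.antisymm
  · rintro _ ⟨_, ⟨f, hf, rfl⟩, rfl⟩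
    obtain ⟨ε, hε, σ, hσ, hsign⟩ := exists_sign_dual_xi_eq_sign_prod ht hf
    have hpoint : chi t x₀ + bangBangPoint volume (Icc 0 t) (fun s => xi m (t - s)) lo hi f =
        boundaryPoint t x₀ lo hi ε σ := by
      rw [boundaryPoint_eq_chi_add_setIntegral ht h hε hσ, bangBangPoint_xi_eq_of_sign_eq hsign]
    rcases hε with rfl | rfl
    · exact Or.inl ⟨σ, hσ, hpoint.symm⟩
    · exact Or.inr ⟨σ, hσ, hpoint.symm⟩
  · have hmem : ∀ ε : ℝ, ε = 1 ∨ ε = -1 → ∀ σ ∈ weylChamber m t,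
        boundaryPoint t x₀ lo hi ε σ ∈ (chi t x₀ + ·) ''
          (bangBangPoint volume (Icc 0 t) (fun s => xi m (t - s)) lo hi '' {f | f ≠ 0}) := by
      intro ε hε σ hσ
      obtain ⟨f, hf, hfσ⟩ := exists_dual_xi_sub_eq_prod t
        (show ε ≠ 0 by rcases hε with rfl | rfl <;> norm_num) σ
      refine ⟨_, ⟨f, hf, rfl⟩, ?_⟩
      simp only [boundaryPoint_eq_chi_add_setIntegral ht h hε hσ, bangBangPoint, hfσ]
    rintro _ (⟨σ, hσ, rfl⟩ | ⟨σ, hσ, rfl⟩)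
    · exact hmem 1 (Or.inl rfl) σ hσ
    · exact hmem (-1) (Or.inr rfl) σ hσ

theorem frontier_integratorReachSet (ht : 0 ≤ t) (h : IsInputRange (Icc 0 t) lo hi)
    (x₀ : Fin (m + 1) → ℝ) :
    frontier (integratorReachSet t x₀ lo hi) =
      boundaryPoint t x₀ lo hi 1 '' weylChamber m t ∪
        boundaryPoint t x₀ lo hi (-1) '' weylChamber m t := by
  have hξ : ContinuousOn (fun s => xi m (t - s)) (Icc 0 t) :=
    (continuous_xi.comp (by fun_prop)).continuousOn
  calc frontier (integratorReachSet t x₀ lo hi)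
      = (chi t x₀ + ·) ''
          frontier (attainableSet volume (Icc 0 t) (fun s => xi m (t - s)) lo hi) := by
        rw [integratorReachSet_eq_image_attainableSet ht]
        exact ((Homeomorph.addLeft (chi t x₀)).image_frontier _).symm
    _ = (chi t x₀ + ·) ''
          (bangBangPoint volume (Icc 0 t) (fun s => xi m (t - s)) lo hi '' {f | f ≠ 0}) := by
        rw [frontier_attainableSet h isCompact_Icc hξ fun f hf =>
          ae_restrict_of_ae (ae_dual_xi_sub_ne_zero hf t)]
    _ = _ := image_bangBangPoint_xi ht h x₀

end Frontier

section CompanionRange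

theorem setIntegral_sub_mem_eq_integral_indicator {E : Type*} [NormedAddCommGroup E]
    [NormedSpace ℝ E] (h : ℝ → E) {S : Set ℝ} (hS : MeasurableSet S) {s : ℝ} (hs : 0 ≤ s) :
    ∫ τ in {τ ∈ Icc 0 s | s - τ ∈ S}, h (s - τ) = ∫ w in 0..s, S.indicator h w := by
  have hS' : MeasurableSet {τ | s - τ ∈ S} := (measurable_id.const_sub s) hS
  calc ∫ τ in {τ ∈ Icc 0 s | s - τ ∈ S}, h (s - τ)
      = ∫ τ in Icc 0 s, S.indicator h (s - τ) := (setIntegral_indicator hS').symm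
    _ = ∫ τ in 0..s, S.indicator h (s - τ) := by
        rw [integral_Icc_eq_integral_Ioc, intervalIntegral.integral_of_le hs]
    _ = ∫ w in 0..s, S.indicator h w := by
        simp [intervalIntegral.integral_comp_sub_left]

theorem continuousOn_setIntegral_sub_mem {E : Type*} [NormedAddCommGroup E] [NormedSpace ℝ E]
    {h : ℝ → E} (hh : LocallyIntegrable h) {S : Set ℝ} (hS : MeasurableSet S) :
    ContinuousOn (fun s => ∫ τ in {τ ∈ Icc 0 s | s - τ ∈ S}, h (s - τ)) (Ici 0) := by
  have hint : ∀ a b, IntervalIntegrable (S.indicator h) volume a b := fun a b =>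
    ((hh.indicator hS).integrableOn_isCompact isCompact_uIcc).intervalIntegrable
  exact (intervalIntegral.continuous_primitive hint 0).continuousOn.congr fun s hs =>
    setIntegral_sub_mem_eq_integral_indicator h hS hs

open scoped Matrix.Norms.Operator in
theorem continuous_exp_smul_mulVec {n : Type*} [Fintype n] [DecidableEq n] (M : Matrix n n ℝ)
    (x : n → ℝ) : Continuous fun s : ℝ => NormedSpace.exp (s • M) *ᵥ x :=
  (continuous_exp_smul M).matrix_mulVec continuous_const

variable {m : ℕ} (A : Matrix (Fin (m + 1)) (Fin (m + 1)) ℝ)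

theorem kernelF_eq_kernelF_sub_zero (s τ : ℝ) : kernelF A s τ = kernelF A (s - τ) 0 := by
  simp [kernelF]

theorem continuous_kernelF_zero : Continuous fun w => kernelF A w 0 := by
  simpa [kernelF] using
    continuous_const.dotProduct (continuous_exp_smul_mulVec (aCon A) (bCon m))

theorem continuousOn_setIntegral_subLevel :
    ContinuousOn (fun s => ∫ τ in subLevel A s, kernelF A s τ) (Ici 0) := by
  simpa only [subLevel, mem_ofPred_eq, ← kernelF_eq_kernelF_sub_zero] using
    continuousOn_setIntegral_sub_mem (continuous_kernelF_zero A).locallyIntegrable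
      (isClosed_le (continuous_kernelF_zero A) continuous_const).measurableSet

theorem continuousOn_setIntegral_superLevel :
    ContinuousOn (fun s => ∫ τ in superLevel A s, kernelF A s τ) (Ici 0) := by
  simpa only [superLevel, mem_ofPred_eq, ← kernelF_eq_kernelF_sub_zero] using
    continuousOn_setIntegral_sub_mem (continuous_kernelF_zero A).locallyIntegrable
      (isOpen_lt continuous_const (continuous_kernelF_zero A)).measurableSet

theorem measurable_kernelF (s : ℝ) : Measurable (kernelF A s) := by
  simpa only [Function.comp_def, ← kernelF_eq_kernelF_sub_zero] using
    ((continuous_kernelF_zero A).comp (continuous_sub_left s)).measurable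

theorem setIntegral_subLevel_nonpos (s : ℝ) : ∫ τ in subLevel A s, kernelF A s τ ≤ 0 :=
  setIntegral_nonpos (measurableSet_Icc.inter (measurable_kernelF A s measurableSet_Iic))
    fun _ hτ => hτ.2

theorem setIntegral_superLevel_nonneg (s : ℝ) : 0 ≤ ∫ τ in superLevel A s, kernelF A s τ :=
  setIntegral_nonneg (measurableSet_Icc.inter (measurable_kernelF A s measurableSet_Ioi))
    fun _ hτ => hτ.2.le

variable {vMin vMax : ℝ}

theorem iMin_le_iMax (hv : vMin ≤ vMax) (s : ℝ) : iMin A vMin vMax s ≤ iMax A vMin vMax s := by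
  have hsub := mul_le_mul_of_nonpos_right hv (setIntegral_subLevel_nonpos A s)
  have hsuper := mul_le_mul_of_nonneg_right hv (setIntegral_superLevel_nonneg A s)
  unfold iMin iMax
  linarith

theorem continuousOn_iMin (vMin vMax : ℝ) : ContinuousOn (iMin A vMin vMax) (Ici 0) :=
  (continuousOn_const.sub ((continuousOn_setIntegral_subLevel A).const_mul vMin)).sub
    ((continuousOn_setIntegral_superLevel A).const_mul vMax)

theorem continuousOn_iMax (vMin vMax : ℝ) : ContinuousOn (iMax A vMin vMax) (Ici 0) :=
  (continuousOn_const.sub ((continuousOn_setIntegral_subLevel A).const_mul vMax)).sub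
    ((continuousOn_setIntegral_superLevel A).const_mul vMin)

/-- The lower end of the integrator input range induced by the companion system
`ẋ = A_con x + b_con v` with `x 0 = x₀` and `vMin ≤ v ≤ vMax`; `uMinLTI` is the case
`x₀ = M z₀`. -/
noncomputable def uMinCompanion (x₀ : Fin (m + 1) → ℝ) (vMin vMax s : ℝ) : ℝ :=
  -(charCoeffs A ⬝ᵥ (NormedSpace.exp (s • aCon A) *ᵥ x₀)) + iMin A vMin vMax s

/-- The upper end of the integrator input range induced by the companion system
`ẋ = A_con x + b_con v` with `x 0 = x₀` and `vMin ≤ v ≤ vMax`; `uMaxLTI` is the case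
`x₀ = M z₀`. -/
noncomputable def uMaxCompanion (x₀ : Fin (m + 1) → ℝ) (vMin vMax s : ℝ) : ℝ :=
  -(charCoeffs A ⬝ᵥ (NormedSpace.exp (s • aCon A) *ᵥ x₀)) + iMax A vMin vMax s

theorem isInputRange_companion (hv : vMin ≤ vMax) (x₀ : Fin (m + 1) → ℝ) :
    IsInputRange (Ici 0) (uMinCompanion A x₀ vMin vMax) (uMaxCompanion A x₀ vMin vMax) := by
  have hfree : ContinuousOn
      (fun s : ℝ => -(charCoeffs A ⬝ᵥ (NormedSpace.exp (s • aCon A) *ᵥ x₀))) (Ici 0) :=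
    (continuous_const.dotProduct (continuous_exp_smul_mulVec (aCon A) x₀)).neg.continuousOn
  exact ⟨hfree.add (continuousOn_iMin A vMin vMax), hfree.add (continuousOn_iMax A vMin vMax),
    fun s _ => add_le_add_right (iMin_le_iMax A hv s) _⟩

end CompanionRange

end LTIReach

open LTIReach in
theorem theorem2_general (m : ℕ) {t : ℝ} (ht : 0 ≤ t) :
    (∀ (x₀ : Fin (m + 1) → ℝ) (uMin uMax : ℝ → ℝ),
      ContinuousOn uMin (Icc 0 t) → ContinuousOn uMax (Icc 0 t) →
      (∀ s ∈ Icc 0 t, uMin s ≤ uMax s) →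
      frontier (integratorReachSet t x₀ uMin uMax) =
        boundaryPoint t x₀ uMin uMax 1 '' weylChamber m t ∪
        boundaryPoint t x₀ uMin uMax (-1) '' weylChamber m t) ∧
    (∀ (A : Matrix (Fin (m + 1)) (Fin (m + 1)) ℝ) (x₀ : Fin (m + 1) → ℝ) (vMin vMax : ℝ),
      vMin ≤ vMax →
      frontier (integratorReachSet t x₀
          (uMinCompanion A x₀ vMin vMax) (uMaxCompanion A x₀ vMin vMax)) =
        boundaryPoint t x₀ (uMinCompanion A x₀ vMin vMax) (uMaxCompanion A x₀ vMin vMax) 1 ''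
          weylChamber m t ∪
        boundaryPoint t x₀ (uMinCompanion A x₀ vMin vMax) (uMaxCompanion A x₀ vMin vMax) (-1) ''
          weylChamber m t) :=
  ⟨fun x₀ _ _ hmin hmax hle => frontier_integratorReachSet ht ⟨hmin, hmax, hle⟩ x₀,
    fun A x₀ _ _ hv => frontier_integratorReachSet ht
      ((isInputRange_companion A hv x₀).mono Icc_subset_Ici_self) x₀⟩

/-- The boundary of the integrator reach set is swept out by the two parametric surfaces over the
Weyl chamber: for every continuous time-varying input range, and in particular for the range
induced by a controllable LTI system with constant input bounds. -/
theorem theorem2 (m : ℕ) (t : ℝ) (ht : 0 < t) :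
    (∀ (x₀ : Fin (m + 1) → ℝ) (uMin uMax : ℝ → ℝ),
      ContinuousOn uMin (Set.Icc 0 t) → ContinuousOn uMax (Set.Icc 0 t) →
      (∀ s ∈ Set.Icc 0 t, uMin s ≤ uMax s) →
      frontier (LTIReach.integratorReachSet t x₀ uMin uMax) =
        LTIReach.boundaryPoint t x₀ uMin uMax 1 '' LTIReach.weylChamber m t ∪
        LTIReach.boundaryPoint t x₀ uMin uMax (-1) '' LTIReach.weylChamber m t) ∧
    (∀ (A : Matrix (Fin (m + 1)) (Fin (m + 1)) ℝ) (b z₀ : Fin (m + 1) → ℝ) (vMin vMax : ℝ),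
      LTIReach.IsControllable A b → vMin ≤ vMax →
      frontier (LTIReach.integratorReachSet t (Matrix.mulVec (LTIReach.toCanonical A b) z₀)
          (LTIReach.uMinLTI A b z₀ vMin vMax) (LTIReach.uMaxLTI A b z₀ vMin vMax)) =
        LTIReach.boundaryPoint t (Matrix.mulVec (LTIReach.toCanonical A b) z₀)
          (LTIReach.uMinLTI A b z₀ vMin vMax) (LTIReach.uMaxLTI A b z₀ vMin vMax) 1 ''
            LTIReach.weylChamber m t ∪
        LTIReach.boundaryPoint t (Matrix.mulVec (LTIReach.toCanonical A b) z₀)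
          (LTIReach.uMinLTI A b z₀ vMin vMax) (LTIReach.uMaxLTI A b z₀ vMin vMax) (-1) ''
            LTIReach.weylChamber m t) := by
  have hgen := theorem2_general m ht.le
  exact ⟨hgen.1, fun A b z₀ vMin vMax _ hv => hgen.2 A _ vMin vMax hv⟩
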